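/- **Theorem 1.1.** A commutative ring $A$ is called *Tor-persistent* if every finitely generated $A$-module $M$ with $\operatorname{Tor}^A_i(M,M)=0$ for all $i\gg 0$ has finite projective dimension over $A$. Let $(R,\mathfrak m,k)$ be a commutative noetherian local ring, let $\widehat R$ be its $\mathfrak m$-adic completion, and let $n\ge 0$ be an integer. The following conditions are equivalent: 1. $R$ is Tor-persistent. 2. $\widehat R$ is Tor-persistent. 3. The power series ring $R[[X_1,\ldots,X_n]]$ is Tor-persistent. 4. The localization $R[X_1,\ldots,X_n]_{(\mathfrak m,X_1,\ldots,X_n)}$ of the polynomial ring at the maximal ideal generated by $\mathfrak m$ and $X_1,\ldots,X_n$ is Tor-persistent. -/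

import Mathlib

universe u

/-- A commutative ring `A` is Tor-persistent if every finitely generated `A`-module `M` with
`Tor^A_i(M, M) = 0` for all `i ≫ 0` has finite projective dimension. (The zero module has
projective dimension `⊥`, which counts as finite.) -/
def IsTorPersistent (A : Type u) [CommRing A] : Prop :=
  ∀ (M : Type u) [AddCommGroup M] [Module A M] [Module.Finite A M],
    (∃ N : ℕ, ∀ i : ℕ, N ≤ i →
      CategoryTheory.Limits.IsZero
        (((CategoryTheory.Tor (ModuleCat.{u} A) i).obj (ModuleCat.of A M)).obj
          (ModuleCat.of A M))) →
    CategoryTheory.projectiveDimension (ModuleCat.of A M) < ⊤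

/-- The ideal `(𝔪, X₁, …, Xₙ)` of `R[X₁, …, Xₙ]`, where `𝔪` is the maximal ideal of `R`. -/
noncomputable def polyMaximalIdeal (R : Type u) [CommRing R] [IsLocalRing R] (n : ℕ) :
    Ideal (MvPolynomial (Fin n) R) :=
  (IsLocalRing.maximalIdeal R).map (MvPolynomial.C : R →+* MvPolynomial (Fin n) R) ⊔
    Ideal.span (Set.range (MvPolynomial.X : Fin n → MvPolynomial (Fin n) R))

theorem polyMaximalIdeal_eq_comap (R : Type u) [CommRing R] [IsLocalRing R] (n : ℕ) :
    polyMaximalIdeal R n =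
      (IsLocalRing.maximalIdeal R).comap
        (MvPolynomial.constantCoeff : MvPolynomial (Fin n) R →+* R) := by
  apply le_antisymm
  · refine sup_le ?_ ?_
    · rw [Ideal.map_le_iff_le_comap]
      intro r hr
      simpa [Ideal.mem_comap] using hr
    · rw [Ideal.span_le]
      rintro _ ⟨i, rfl⟩
      simp
  · intro p hp
    have key : ∀ q : MvPolynomial (Fin n) R,
        q - MvPolynomial.C (MvPolynomial.constantCoeff q) ∈
          Ideal.span (Set.range (MvPolynomial.X : Fin n → MvPolynomial (Fin n) R)) := by
      intro q
      induction q using MvPolynomial.induction_on with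
      | C a => simp
      | add p q hp hq =>
        have h := add_mem hp hq
        simp only [map_add]
        convert h using 1
        ring
      | mul_X p i hp =>
        simp only [map_mul, MvPolynomial.constantCoeff_X, mul_zero, map_zero, sub_zero]
        exact Ideal.mul_mem_left _ _ (Ideal.subset_span ⟨i, rfl⟩)
    rw [Ideal.mem_comap] at hp
    have h := Submodule.add_mem_sup
      (Ideal.mem_map_of_mem (MvPolynomial.C : R →+* MvPolynomial (Fin n) R) hp) (key p)
    simpa [polyMaximalIdeal] using h

instance polyMaximalIdeal_isPrime (R : Type u) [CommRing R] [IsLocalRing R] (n : ℕ) :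
    (polyMaximalIdeal R n).IsPrime := by
  rw [polyMaximalIdeal_eq_comap]
  infer_instance

/-!
Everything rests on one change-of-rings statement. Let `A` be a noetherian local ring with maximal
ideal `𝔪` and residue field `k`, and let `x ∈ 𝔪 \ 𝔪²` be a nonzerodivisor. Then `A` is
Tor-persistent if and only if `A/x` is.

* From `A/x` to `A` (`IsTorPersistent.of_quotient_regular`): if `Tor^A(M, M)` vanishes in large
  degrees, then so does `Tor^A(K, K)` for a first syzygy `K` of `M`. As `x` is regular on `K`, one has
  `Tor^A(K, Y) = Tor^{A/x}(K/xK, Y)` for every `A/x`-module `Y`. With `Y = K/xK` this makes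
  `K/xK` a test module over `A/x`, and with `Y = k` finiteness of its projective dimension is
  transferred back to `K`.
* From `A` to `A/x` (`IsTorPersistent.quotient_regular`): if `Tor^{A/x}(N, N)` vanishes in large
  degrees, then so does `Tor^A(N, N)` by the change-of-rings sequence. Hence `N` has finite projective
  dimension over `A`, and `Tor^A(N, 𝔪) = Tor^{A/x}(N, 𝔪/x𝔪)` vanishes in large degrees. Since
  `x ∉ 𝔪²`, the residue field is a direct summand of `𝔪/x𝔪` (Nagata), so `Tor^{A/x}(N, k)` vanishes
  in large degrees as well.

All the rings of the theorem are linked to `R` by chains of such quotients.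

* `R⟦X₁, …, Xₙ₊₁⟧` modulo one variable is `R⟦X₁, …, Xₙ⟧`, and likewise for the localized polynomial
  rings.
* If `𝔪 = (a₁, …, aᵣ)`, the completion is reached from `R` by passing `r` times from a ring `S` to
  `S⟦X⟧` and on to `S⟦X⟧/(X - a)`. The element `X - a` is a nonzerodivisor by Krull's intersection
  theorem, and it is not in the square of the maximal ideal because its derivative is `1`.

Only vanishing of Tor matters, so Tor is handled through the predicate `TorSuccVanishes`, defined by
dimension shifting; `isZero_tor_succ_iff` identifies it with vanishing of Mathlib's `Tor`.
-/

/-! ### Vanishing of Tor by dimension shifting -/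

section TorVanishing

open Function TensorProduct

variable {A : Type u} [CommRing A]

variable (A) in
/-- The first syzygy of `X` with respect to its canonical free cover `X →₀ A`. -/
def Syzygy (X : Type u) [AddCommGroup X] [Module A X] : Type u :=
  LinearMap.ker (Finsupp.linearCombination A (id : X → X))

namespace Syzygy

variable (A) (X : Type u) [AddCommGroup X] [Module A X]

noncomputable instance : AddCommGroup (Syzygy A X) :=
  inferInstanceAs (AddCommGroup (LinearMap.ker (Finsupp.linearCombination A (id : X → X))))

noncomputable instance : Module A (Syzygy A X) :=
  inferInstanceAs (Module A (LinearMap.ker (Finsupp.linearCombination A (id : X → X))))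

/-- The inclusion of the first syzygy into the free cover. -/
noncomputable def incl : Syzygy A X →ₗ[A] (X →₀ A) :=
  (LinearMap.ker (Finsupp.linearCombination A (id : X → X))).subtype

/-- The canonical free cover. -/
noncomputable def cover : (X →₀ A) →ₗ[A] X := Finsupp.linearCombination A (id : X → X)

theorem incl_injective : Injective (incl A X) := Subtype.val_injective

theorem cover_surjective : Surjective (cover A X) :=
  Finsupp.linearCombination_id_surjective A X

theorem exact : Exact (incl A X) (cover A X) := LinearMap.exact_subtype_ker_map _

end Syzygy

variable (A) in
/-- `TorSuccVanishes A Y i X` says that `Tor^A_{i+1}(X, Y) = 0`. For `i = 0` this is phrased as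
injectivity of `K ⊗ Y → F ⊗ Y`, where `0 → K → F → X → 0` is the canonical free presentation of
`X`; for larger `i` it is reduced to `K` by dimension shifting. -/
def TorSuccVanishes (Y : Type u) [AddCommGroup Y] [Module A Y] :
    ℕ → ∀ (X : Type u) [AddCommGroup X] [Module A X], Prop
  | 0, X, _, _ => Injective ((Syzygy.incl A X).rTensor Y)
  | i + 1, X, _, _ => TorSuccVanishes Y i (Syzygy A X)

variable {K L X Y Y' Y'' : Type u}
  [AddCommGroup K] [Module A K] [AddCommGroup L] [Module A L] [AddCommGroup X] [Module A X]
  [AddCommGroup Y] [Module A Y] [AddCommGroup Y'] [Module A Y'] [AddCommGroup Y''] [Module A Y'']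

/-- The two ways to express `Tor₁(X, Y) = 0`, through a flat presentation of `X` and through a flat
presentation of `Y`, agree. -/
theorem rTensor_injective_iff_lTensor_injective {G Q : Type u} [AddCommGroup G] [Module A G]
    [AddCommGroup Q] [Module A Q] [Module.Flat A L] [Module.Flat A Q]
    {f : K →ₗ[A] L} {p : L →ₗ[A] X} (hf : Injective f) (hfp : Exact f p) (hp : Surjective p)
    {g : G →ₗ[A] Q} {q : Q →ₗ[A] Y} (hg : Injective g) (hgq : Exact g q) (hq : Surjective q) :
    Injective (f.rTensor Y) ↔ Injective (g.lTensor X) := by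
  constructor
  · intro h
    exact lTensor_injective_of_exact_of_exact_of_rTensor_injective hfp hp hgq hq h
      (Module.Flat.lTensor_preserves_injective_linearMap _ hg)
  · intro h
    rw [← LinearMap.lTensor_inj_iff_rTensor_inj]
    exact lTensor_injective_of_exact_of_exact_of_rTensor_injective hgq hq hfp hp
      ((LinearMap.lTensor_inj_iff_rTensor_inj _ _).1 h)
      (Module.Flat.lTensor_preserves_injective_linearMap _ hf)

/-- Vanishing of `Tor₁(X, Y)` may be tested on any flat presentation of `X`. -/
theorem torSuccVanishes_zero_iff [Module.Flat A L]
    {f : K →ₗ[A] L} {p : L →ₗ[A] X} (hf : Injective f) (hfp : Exact f p) (hp : Surjective p) :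
    TorSuccVanishes A Y 0 X ↔ Injective (f.rTensor Y) :=
  (rTensor_injective_iff_lTensor_injective (Syzygy.incl_injective _ _) (Syzygy.exact A X)
    (Syzygy.cover_surjective A X) (Syzygy.incl_injective _ _) (Syzygy.exact A Y)
    (Syzygy.cover_surjective A Y)).trans
  (rTensor_injective_iff_lTensor_injective hf hfp hp (Syzygy.incl_injective _ _)
    (Syzygy.exact A Y) (Syzygy.cover_surjective A Y)).symm

theorem torSuccVanishes_zero_comm : TorSuccVanishes A Y 0 X ↔ TorSuccVanishes A X 0 Y :=
  (rTensor_injective_iff_lTensor_injective (Syzygy.incl_injective _ _) (Syzygy.exact A X)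
    (Syzygy.cover_surjective A X) (Syzygy.incl_injective _ _) (Syzygy.exact A Y)
    (Syzygy.cover_surjective A Y)).trans (LinearMap.lTensor_inj_iff_rTensor_inj _ _)

theorem torSuccVanishes_of_flat (i : ℕ) [Module.Flat A Y] : TorSuccVanishes A Y i X := by
  induction i generalizing X with
  | zero => exact Module.Flat.rTensor_preserves_injective_linearMap _ (Syzygy.incl_injective _ _)
  | succ i ih => exact ih

theorem TorSuccVanishes.of_retract {i : ℕ} {s : Y' →ₗ[A] Y} {r : Y →ₗ[A] Y'}
    (hrs : r ∘ₗ s = LinearMap.id) (h : TorSuccVanishes A Y i X) : TorSuccVanishes A Y' i X := by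
  induction i generalizing X with
  | zero =>
    have hs : Injective (s.lTensor (Syzygy A X)) := by
      refine LeftInverse.injective (g := r.lTensor _) fun x ↦ ?_
      rw [← LinearMap.comp_apply, ← LinearMap.lTensor_comp, hrs, LinearMap.lTensor_id,
        LinearMap.id_apply]
    have h1 : Injective ((Syzygy.incl A X).rTensor Y ∘ₗ s.lTensor (Syzygy A X)) := by
      rw [LinearMap.coe_comp]
      exact Injective.comp h hs
    rw [LinearMap.rTensor_comp_lTensor, ← LinearMap.lTensor_comp_rTensor, LinearMap.coe_comp] at h1
    exact h1.of_comp
  | succ i ih => exact ih h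

section LongExactSequence

variable {a : Y' →ₗ[A] Y} {b : Y →ₗ[A] Y''}

/-- The diagram chase behind `TorSuccVanishes.middle`. -/
theorem rTensor_injective_of_exact [Module.Flat A L] {f : K →ₗ[A] L} (ha : Injective a)
    (hab : Exact a b) (hb : Surjective b) (h' : Injective (f.rTensor Y'))
    (h'' : Injective (f.rTensor Y'')) : Injective (f.rTensor Y) := by
  refine (injective_iff_map_eq_zero _).2 fun k hk ↦ ?_
  have h1 : b.lTensor K k = 0 := by
    apply h''
    rw [← LinearMap.comp_apply, LinearMap.rTensor_comp_lTensor, ← LinearMap.lTensor_comp_rTensor,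
      LinearMap.comp_apply, hk, map_zero, map_zero]
  obtain ⟨k', rfl⟩ := (lTensor_exact K hab hb k).1 h1
  have h2 : f.rTensor Y' k' = 0 := by
    apply Module.Flat.lTensor_preserves_injective_linearMap (M := L) a ha
    rw [← LinearMap.comp_apply, LinearMap.lTensor_comp_rTensor, ← LinearMap.rTensor_comp_lTensor,
      LinearMap.comp_apply, hk, map_zero]
  rw [h2.trans (map_zero _).symm |> @h' k' 0, map_zero]

/-- Exactness of `Tor(X, Y') → Tor(X, Y) → Tor(X, Y'')`, for vanishing. -/
theorem TorSuccVanishes.middle {i : ℕ} (ha : Injective a) (hab : Exact a b) (hb : Surjective b)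
    (h' : TorSuccVanishes A Y' i X) (h'' : TorSuccVanishes A Y'' i X) :
    TorSuccVanishes A Y i X := by
  induction i generalizing X with
  | zero => exact rTensor_injective_of_exact ha hab hb h' h''
  | succ i ih => exact ih h' h''

/-- Exactness of `Tor_{i+2}(X, Y'') → Tor_{i+1}(X, Y') → Tor_{i+1}(X, Y)`, for vanishing. -/
theorem TorSuccVanishes.left {i : ℕ} (ha : Injective a) (hab : Exact a b) (hb : Surjective b)
    (h'' : TorSuccVanishes A Y'' (i + 1) X) (h : TorSuccVanishes A Y i X) :
    TorSuccVanishes A Y' i X := by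
  induction i generalizing X with
  | zero =>
    have h1 : Injective (a.lTensor (Syzygy A X)) :=
      lTensor_injective_of_exact_of_exact_of_rTensor_injective (Syzygy.exact A _)
        (Syzygy.cover_surjective A _) hab hb h''
        (Module.Flat.lTensor_preserves_injective_linearMap _ ha)
    have h2 : Injective ((Syzygy.incl A X).rTensor Y ∘ₗ a.lTensor (Syzygy A X)) := by
      rw [LinearMap.coe_comp]
      exact Injective.comp h h1
    rw [LinearMap.rTensor_comp_lTensor, ← LinearMap.lTensor_comp_rTensor, LinearMap.coe_comp] at h2
    exact h2.of_comp
  | succ i ih => exact ih h'' h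

/-- Exactness of `Tor_{i+2}(X, Y) → Tor_{i+2}(X, Y'') → Tor_{i+1}(X, Y')`, for vanishing. -/
theorem TorSuccVanishes.right {i : ℕ} (ha : Injective a) (hab : Exact a b) (hb : Surjective b)
    (h' : TorSuccVanishes A Y' i X) (h : TorSuccVanishes A Y (i + 1) X) :
    TorSuccVanishes A Y'' (i + 1) X := by
  induction i generalizing X with
  | zero =>
    have h1 : Injective (a.lTensor (Syzygy A X)) := by
      have h2 : Injective (a.lTensor (X →₀ A) ∘ₗ (Syzygy.incl A X).rTensor Y') := by
        rw [LinearMap.coe_comp]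
        exact (Module.Flat.lTensor_preserves_injective_linearMap _ ha).comp h'
      rw [LinearMap.lTensor_comp_rTensor, ← LinearMap.rTensor_comp_lTensor, LinearMap.coe_comp]
        at h2
      exact h2.of_comp
    change Injective _
    rw [← LinearMap.lTensor_inj_iff_rTensor_inj]
    exact lTensor_injective_of_exact_of_exact_of_rTensor_injective hab hb
      (Syzygy.exact A _) (Syzygy.cover_surjective A _)
      ((LinearMap.lTensor_inj_iff_rTensor_inj _ _).1 h1)
      ((LinearMap.lTensor_inj_iff_rTensor_inj _ _).2 h)
  | succ i ih => exact ih h' h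

end LongExactSequence

theorem torSuccVanishes_succ_iff_right {i : ℕ} [Module.Flat A L] {f : K →ₗ[A] L} {p : L →ₗ[A] Y}
    (hf : Injective f) (hfp : Exact f p) (hp : Surjective p) :
    TorSuccVanishes A Y (i + 1) X ↔ TorSuccVanishes A K i X :=
  ⟨fun h ↦ h.left hf hfp hp (torSuccVanishes_of_flat i),
    fun h ↦ h.right hf hfp hp (torSuccVanishes_of_flat (i + 1))⟩

/-- Symmetry of Tor: dimension shifting holds in the first variable by definition and in the second
by the long exact sequence, which reduces the claim to `Tor₁`. -/
theorem torSuccVanishes_comm {i : ℕ} : TorSuccVanishes A Y i X ↔ TorSuccVanishes A X i Y := by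
  induction i generalizing X with
  | zero => exact torSuccVanishes_zero_comm
  | succ i ih =>
    exact (ih (X := Syzygy A X)).trans
      (torSuccVanishes_succ_iff_right (Syzygy.incl_injective _ _) (Syzygy.exact A X)
        (Syzygy.cover_surjective A X)).symm

theorem torSuccVanishes_succ_iff {i : ℕ} [Module.Flat A L] {f : K →ₗ[A] L} {p : L →ₗ[A] X}
    (hf : Injective f) (hfp : Exact f p) (hp : Surjective p) :
    TorSuccVanishes A Y (i + 1) X ↔ TorSuccVanishes A Y i K := by
  rw [torSuccVanishes_comm, torSuccVanishes_succ_iff_right hf hfp hp, torSuccVanishes_comm]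

section BaseChange

variable {B : Type u} [CommRing B] [Algebra A B] {f : K →ₗ[A] L} {p : L →ₗ[A] X}

theorem baseChange_injective_of_torSuccVanishes [Module.Flat A L] (hf : Injective f)
    (hfp : Exact f p) (hp : Surjective p) (hX : TorSuccVanishes A B 0 X) :
    Injective (f.baseChange B) :=
  (LinearMap.lTensor_inj_iff_rTensor_inj B f).2 ((torSuccVanishes_zero_iff hf hfp hp).1 hX)

theorem baseChange_exact (hfp : Exact f p) (hp : Surjective p) :
    Exact (f.baseChange B) (p.baseChange B) :=
  lTensor_exact B hfp hp

theorem baseChange_surjective (hp : Surjective p) : Surjective (p.baseChange B) :=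
  LinearMap.lTensor_surjective B hp

variable [Module B Y] [IsScalarTower A B Y]

theorem rTensor_baseChange_injective_iff :
    Injective ((f.baseChange B).rTensor Y) ↔ Injective (f.rTensor Y) := by
  rw [← LinearMap.lTensor_inj_iff_rTensor_inj, ← LinearMap.lTensor_inj_iff_rTensor_inj]
  have key : ∀ x, AlgebraTensorModule.cancelBaseChange A B B Y L ((f.baseChange B).lTensor Y x) =
      f.lTensor Y (AlgebraTensorModule.cancelBaseChange A B B Y K x) := by
    intro x
    induction x with
    | zero => simp
    | add x y hx hy => simp only [map_add, hx, hy]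
    | tmul y z =>
      induction z with
      | zero => simp
      | add x y hx hy => simp only [map_add, tmul_add, hx, hy]
      | tmul b k => simp
  constructor
  · intro h x y hxy
    obtain ⟨x, rfl⟩ := (AlgebraTensorModule.cancelBaseChange A B B Y K).surjective x
    obtain ⟨y, rfl⟩ := (AlgebraTensorModule.cancelBaseChange A B B Y K).surjective y
    rw [← key, ← key] at hxy
    rw [h (LinearEquiv.injective _ hxy)]
  · intro h x y hxy
    apply (AlgebraTensorModule.cancelBaseChange A B B Y K).injective
    apply h
    rw [← key, ← key, hxy]

/-- If `Tor^A_i(X, B) = 0` for all `i > 0`, then `Tor^A_i(X, Y) = Tor^B_i(B ⊗ X, Y)` for every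
`B`-module `Y`, as tensoring a free resolution of `X` with `B` gives a free resolution. -/
theorem torSuccVanishes_baseChange_iff (hX : ∀ i, TorSuccVanishes A B i X) (i : ℕ) :
    TorSuccVanishes B Y i (B ⊗[A] X) ↔ TorSuccVanishes A Y i X := by
  have hinj {X : Type u} [AddCommGroup X] [Module A X] (h : TorSuccVanishes A B 0 X) :=
    baseChange_injective_of_torSuccVanishes (Syzygy.incl_injective _ _) (Syzygy.exact A X)
      (Syzygy.cover_surjective A X) h
  induction i generalizing X with
  | zero =>
    rw [torSuccVanishes_zero_iff (hinj (hX 0))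
      (baseChange_exact (Syzygy.exact A X) (Syzygy.cover_surjective A X))
      (baseChange_surjective (Syzygy.cover_surjective A X))]
    exact rTensor_baseChange_injective_iff
  | succ i ih =>
    rw [torSuccVanishes_succ_iff (hinj (hX 0))
      (baseChange_exact (Syzygy.exact A X) (Syzygy.cover_surjective A X))
      (baseChange_surjective (Syzygy.cover_surjective A X))]
    exact ih fun i ↦ hX (i + 1)

end BaseChange

end TorVanishing

/-! ### Comparison with Mathlib's Tor and with projective dimension -/

section Comparison

open Function TensorProduct CategoryTheory

variable {A : Type u} [CommRing A]

theorem exact_lTensor_comp_iff {P₀ P₁ P₂ K X : Type u} [AddCommGroup P₀] [Module A P₀]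
    [AddCommGroup P₁] [Module A P₁] [AddCommGroup P₂] [Module A P₂] [AddCommGroup K] [Module A K]
    [AddCommGroup X] [Module A X] {d : P₂ →ₗ[A] P₁} {e : P₁ →ₗ[A] K} (f : K →ₗ[A] P₀)
    (hde : Exact d e) (he : Surjective e) :
    Exact (d.lTensor X) ((f ∘ₗ e).lTensor X) ↔ Injective (f.lTensor X) := by
  have hX := lTensor_exact X hde he
  have heX := LinearMap.lTensor_surjective X he
  rw [LinearMap.lTensor_comp]
  constructor
  · intro h
    refine (injective_iff_map_eq_zero _).2 fun k hk ↦ ?_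
    obtain ⟨p, rfl⟩ := heX k
    exact (hX p).2 ((h p).1 hk)
  · intro h p
    rw [LinearMap.comp_apply, map_eq_zero_iff _ h]
    exact hX p

/-- A four-term exact sequence `P₂ → P₁ → P₀ → Y` is split into a three-term and a short exact one
along the image of `P₁ → P₀`. -/
theorem exists_exact_factorization {P₀ P₁ P₂ Y : Type u} [AddCommGroup P₀] [Module A P₀]
    [AddCommGroup P₁] [Module A P₁] [AddCommGroup P₂] [Module A P₂] [AddCommGroup Y] [Module A Y]
    {d₁ : P₂ →ₗ[A] P₁} {d₀ : P₁ →ₗ[A] P₀} {p : P₀ →ₗ[A] Y} (h₁ : Exact d₁ d₀) (h₀ : Exact d₀ p) :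
    ∃ (K : ModuleCat.{u} A) (e : P₁ →ₗ[A] K) (f : K →ₗ[A] P₀),
      f ∘ₗ e = d₀ ∧ Surjective e ∧ Injective f ∧ Exact d₁ e ∧ Exact f p := by
  refine ⟨ModuleCat.of A (LinearMap.range d₀), d₀.rangeRestrict, (LinearMap.range d₀).subtype,
    rfl, d₀.surjective_rangeRestrict, Subtype.val_injective, fun x ↦ ?_, fun x ↦ ?_⟩
  · rw [← h₁ x]
    exact Subtype.ext_iff
  · rw [h₀ x]
    exact ⟨fun ⟨y, hy⟩ ↦ ⟨⟨x, y, hy⟩, rfl⟩, fun ⟨⟨_, y, hy⟩, h⟩ ↦ ⟨y, hy.trans h⟩⟩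

/-- Vanishing of Tor can be tested on any flat resolution `⋯ → P 1 → P 0 → Y → 0`. -/
theorem torSuccVanishes_iff_exact_lTensor (X : Type u) [AddCommGroup X] [Module A X] (i : ℕ)
    (Y : Type u) [AddCommGroup Y] [Module A Y] (P : ℕ → ModuleCat.{u} A)
    [∀ n, Module.Flat A (P n)] (d : ∀ n, P (n + 1) →ₗ[A] P n) (p : P 0 →ₗ[A] Y)
    (hp : Surjective p) (hdp : Exact (d 0) p) (hd : ∀ n, Exact (d (n + 1)) (d n)) :
    TorSuccVanishes A X i Y ↔ Exact ((d (i + 1)).lTensor X) ((d i).lTensor X) := by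
  induction i generalizing Y P with
  | zero =>
    obtain ⟨K, e, f, hef, he, hf, hde, hfp⟩ := exists_exact_factorization (hd 0) hdp
    rw [torSuccVanishes_zero_iff hf hfp hp, ← hef, exact_lTensor_comp_iff f hde he,
      LinearMap.lTensor_inj_iff_rTensor_inj]
  | succ i ih =>
    obtain ⟨K, e, f, hef, he, hf, hde, hfp⟩ := exists_exact_factorization (hd 0) hdp
    rw [torSuccVanishes_succ_iff hf hfp hp]
    exact ih K (fun n ↦ P (n + 1)) (fun n ↦ d (n + 1)) e he hde fun n ↦ hd (n + 1)

/-- Mathlib derives `X ⊗ Y` in the variable `Y`, hence the order of the arguments on the right. -/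
theorem isZero_tor_succ_iff (X Y : Type u) [AddCommGroup X] [Module A X] [AddCommGroup Y]
    [Module A Y] (i : ℕ) :
    Limits.IsZero (((Tor (ModuleCat.{u} A) (i + 1)).obj (ModuleCat.of A X)).obj
      (ModuleCat.of A Y)) ↔ TorSuccVanishes A X i Y := by
  let R := projectiveResolution (ModuleCat.of A Y)
  have hflat (n : ℕ) : Module.Flat A (R.complex.X n) := by
    have : Module.Projective A (R.complex.X n) :=
      (IsProjective.iff_projective (R.complex.X n)).2 (R.projective n)
    infer_instance
  have hexact (n : ℕ) : Exact (R.complex.d (n + 2) (n + 1)).hom (R.complex.d (n + 1) n).hom :=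
    (ShortComplex.ShortExact.moduleCat_exact_iff_function_exact _).1 (R.exact_succ n)
  refine Iff.trans ?_ (torSuccVanishes_iff_exact_lTensor X i Y (fun n ↦ R.complex.X n)
    (fun n ↦ (R.complex.d (n + 1) n).hom) (R.π.f 0).hom
    ((ModuleCat.epi_iff_surjective _).1 inferInstance)
    ((ShortComplex.ShortExact.moduleCat_exact_iff_function_exact _).1 R.exact₀) hexact).symm
  let F : ModuleCat.{u} A ⥤ ModuleCat.{u} A :=
    (MonoidalCategory.tensoringLeft (ModuleCat.{u} A)).obj (ModuleCat.of A X)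
  have h1 := (R.isoLeftDerivedObj F (i + 1)).isZero_iff
  refine h1.trans ?_
  refine (HomologicalComplex.exactAt_iff_isZero_homology _ _).symm.trans ?_
  rw [HomologicalComplex.exactAt_iff' _ (i + 2) (i + 1) i (by simp) (by simp)]
  exact ShortComplex.ShortExact.moduleCat_exact_iff_function_exact _

theorem torSuccVanishes_of_hasProjectiveDimensionLT (n : ℕ) (X Y : Type u) [AddCommGroup X]
    [Module A X] [AddCommGroup Y] [Module A Y]
    (h : HasProjectiveDimensionLT (ModuleCat.of A X) (n + 1)) (i : ℕ) (hi : n ≤ i) :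
    TorSuccVanishes A Y i X := by
  induction n generalizing X i with
  | zero =>
    have h1 := (projective_iff_hasProjectiveDimensionLT_one).2 h
    have : Module.Projective A X := (IsProjective.iff_projective (ModuleCat.of A X)).2 h1
    exact torSuccVanishes_comm.2 (torSuccVanishes_of_flat i)
  | succ n ih =>
    obtain ⟨i, rfl⟩ := Nat.exists_eq_succ_of_ne_zero (by omega : i ≠ 0)
    refine ih (Syzygy A X) ?_ i (by omega)
    exact ((LinearMap.shortExact_shortComplexKer
      (Syzygy.cover_surjective A X)).hasProjectiveDimensionLT_X₃_iff n
        (ModuleCat.projective_of_free (Module.Free.chooseBasis A (X →₀ A)))).1 h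

variable (A) in
theorem exists_finite_free_presentation [IsNoetherianRing A] (X : Type u) [AddCommGroup X]
    [Module A X] [Module.Finite A X] :
    ∃ (n : ℕ) (K : ModuleCat.{u} A) (f : K →ₗ[A] (Fin n → A)) (p : (Fin n → A) →ₗ[A] X),
      Module.Finite A K ∧ Injective f ∧ Exact f p ∧ Surjective p := by
  obtain ⟨n, p, hp⟩ := Module.Finite.exists_fin' A X
  exact ⟨n, ModuleCat.of A (LinearMap.ker p), (LinearMap.ker p).subtype, p,
    inferInstanceAs (Module.Finite A (LinearMap.ker p)), Subtype.val_injective,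
    p.exact_subtype_ker_map, hp⟩

/-- Over a noetherian local ring, vanishing of a single `Tor_{n+1}(X, k)` bounds the projective
dimension of `X` by `n`. -/
theorem hasProjectiveDimensionLT_of_torSuccVanishes [IsLocalRing A] [IsNoetherianRing A] (n : ℕ)
    (X : Type u) [AddCommGroup X] [Module A X] [Module.Finite A X]
    (h : TorSuccVanishes A (IsLocalRing.ResidueField A) n X) :
    HasProjectiveDimensionLT (ModuleCat.of A X) (n + 1) := by
  induction n generalizing X with
  | zero =>
    obtain ⟨m, K, f, p, _, hf, hfp, hp⟩ := exists_finite_free_presentation A X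
    rw [torSuccVanishes_zero_iff hf hfp hp, ← LinearMap.lTensor_inj_iff_rTensor_inj] at h
    have : Module.Free A X := Module.free_of_lTensor_residueField_injective _ _ hp hfp h
    exact projective_iff_hasProjectiveDimensionLT_one.1
      (ModuleCat.projective_of_free (Module.Free.chooseBasis A X))
  | succ n ih =>
    obtain ⟨m, p, hp⟩ := Module.Finite.exists_fin' A X
    rw [torSuccVanishes_succ_iff Subtype.val_injective p.exact_subtype_ker_map hp] at h
    exact ((LinearMap.shortExact_shortComplexKer hp).hasProjectiveDimensionLT_X₃_iff n
        (ModuleCat.projective_of_free (Pi.basisFun A (Fin m)))).2 (ih (LinearMap.ker p) h)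

/-- A noetherian local ring is Tor-persistent exactly when vanishing of `Tor_i(M, M)` for all large
`i` forces vanishing of `Tor_i(M, k)` for all large `i`, `k` being the residue field. -/
theorem isTorPersistent_iff [IsLocalRing A] [IsNoetherianRing A] :
    IsTorPersistent A ↔ ∀ (M : Type u) [AddCommGroup M] [Module A M] [Module.Finite A M],
      (∃ N, ∀ i, N ≤ i → TorSuccVanishes A M i M) →
      ∃ N, ∀ i, N ≤ i → TorSuccVanishes A (IsLocalRing.ResidueField A) i M := by
  have hpd (M : Type u) [AddCommGroup M] [Module A M] [Module.Finite A M] :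
      projectiveDimension (ModuleCat.of A M) < ⊤ ↔
        ∃ N, ∀ i, N ≤ i → TorSuccVanishes A (IsLocalRing.ResidueField A) i M := by
    rw [lt_top_iff_ne_top, projectiveDimension_ne_top_iff]
    constructor
    · rintro ⟨n, hn⟩
      exact ⟨n, torSuccVanishes_of_hasProjectiveDimensionLT n M _ hn⟩
    · rintro ⟨N, hN⟩
      exact ⟨N, hasProjectiveDimensionLT_of_torSuccVanishes N M (hN N le_rfl)⟩
  refine forall_congr' fun M ↦ forall_congr' fun _ ↦ forall_congr' fun _ ↦ forall_congr' fun _ ↦ ?_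
  rw [hpd]
  refine imp_congr_left ⟨?_, ?_⟩
  · rintro ⟨N, hN⟩
    exact ⟨N, fun i hi ↦ (isZero_tor_succ_iff M M i).1 (hN (i + 1) (by omega))⟩
  · rintro ⟨N, hN⟩
    refine ⟨N + 1, fun i hi ↦ ?_⟩
    obtain ⟨i, rfl⟩ := Nat.exists_eq_succ_of_ne_zero (by omega : i ≠ 0)
    exact (isZero_tor_succ_iff M M i).2 (hN i (by omega))

end Comparison

/-! ### Passing to the quotient by a regular element -/

section RegularQuotient

open Function TensorProduct IsLocalRing

variable {A B : Type u} [CommRing A] [CommRing B] [Algebra A B] {x : A}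
  {X : Type u} [AddCommGroup X] [Module A X]

theorem exact_smul_algebraMap (hker : RingHom.ker (algebraMap A B) = Ideal.span {x}) :
    Exact (x • (LinearMap.id : A →ₗ[A] A)) (Algebra.linearMap A B) := fun a ↦ by
  rw [Algebra.linearMap_apply, ← RingHom.mem_ker, hker, Ideal.mem_span_singleton']
  simp [mul_comm x]

theorem lid_rTensor_smul (z : A ⊗[A] X) :
    TensorProduct.lid A X ((x • (LinearMap.id : A →ₗ[A] A)).rTensor X z) =
      x • TensorProduct.lid A X z := by
  induction z with
  | zero => simp
  | add y z hy hz => simp only [map_add, smul_add, hy, hz]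
  | tmul a y => simp

/-- `A/x` has the free resolution `0 → A → A → A/x → 0`, so that `Tor^A_i(X, A/x) = 0` for all
`i > 0` if `x` is regular on `X`. -/
theorem torSuccVanishes_quotient (hsurj : Surjective (algebraMap A B))
    (hker : RingHom.ker (algebraMap A B) = Ideal.span {x}) (hx : IsSMulRegular A x)
    (hX : IsSMulRegular X x) (i : ℕ) : TorSuccVanishes A B i X := by
  have hinj : Injective (x • (LinearMap.id : A →ₗ[A] A)) := hx
  rw [torSuccVanishes_comm]
  cases i with
  | zero =>
    rw [torSuccVanishes_zero_iff hinj (exact_smul_algebraMap hker) hsurj]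
    intro y z hyz
    apply (TensorProduct.lid A X).injective
    apply hX
    simp only [← lid_rTensor_smul, hyz]
  | succ i =>
    rw [torSuccVanishes_succ_iff hinj (exact_smul_algebraMap hker) hsurj, torSuccVanishes_comm]
    exact torSuccVanishes_of_flat i

theorem one_tmul_eq_zero_iff (hsurj : Surjective (algebraMap A B))
    (hker : RingHom.ker (algebraMap A B) = Ideal.span {x}) (z : X) :
    (1 : B) ⊗ₜ[A] z = 0 ↔ ∃ y, x • y = z := by
  constructor
  · intro h
    obtain ⟨w, hw⟩ := (rTensor_exact X (exact_smul_algebraMap hker) hsurj ((1 : A) ⊗ₜ[A] z)).1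
      (by simpa using h)
    exact ⟨TensorProduct.lid A X w, by rw [← lid_rTensor_smul, hw]; simp⟩
  · rintro ⟨y, rfl⟩
    have hx0 : algebraMap A B x = 0 := by
      rw [← RingHom.mem_ker, hker]
      exact Ideal.mem_span_singleton_self x
    rw [← smul_tmul, Algebra.smul_def, hx0, zero_mul, zero_tmul]

/-- The quotient `X → B ⊗ X` is `X → X/xX`. -/
theorem exact_smul_mk (hsurj : Surjective (algebraMap A B))
    (hker : RingHom.ker (algebraMap A B) = Ideal.span {x}) :
    Exact (x • (LinearMap.id : X →ₗ[A] X)) (TensorProduct.mk A B X 1) := fun z ↦ by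
  rw [TensorProduct.mk_apply, one_tmul_eq_zero_iff hsurj hker]
  simp

/-- If `x` is regular on `F ⊇ L`, and `N = F/L` is annihilated by `x`, then multiplication by `x`
embeds `N` into `L/xL`, with image the kernel of `L/xL → F/xF`. -/
theorem exists_injective_exact_baseChange {L F N : Type u} [AddCommGroup L] [Module A L]
    [AddCommGroup F] [Module A F] [AddCommGroup N] [Module A N] [Module B N] [IsScalarTower A B N]
    (hsurj : Surjective (algebraMap A B))
    (hker : RingHom.ker (algebraMap A B) = Ideal.span {x}) (hF : IsSMulRegular F x)
    {f : L →ₗ[A] F} {p : F →ₗ[A] N} (hf : Injective f) (hfp : Exact f p) (hp : Surjective p) :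
    ∃ j : N →ₗ[B] B ⊗[A] L, Injective j ∧ Exact j (f.baseChange B) := by
  have hx0 : algebraMap A B x = 0 := by
    rw [← RingHom.mem_ker, hker]
    exact Ideal.mem_span_singleton_self x
  have hpx (a : F) : p (x • a) = 0 := by
    rw [map_smul, ← algebraMap_smul B, hx0, zero_smul]
  -- `s` is multiplication by `x` on `F`, which has values in `L` because `x N = 0`.
  let e := LinearEquiv.ofInjective f hf
  let s : F →ₗ[A] L := e.symm.toLinearMap ∘ₗ
    (x • LinearMap.id : F →ₗ[A] F).codRestrict (LinearMap.range f) fun a ↦ (hfp _).1 (hpx a)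
  have hs (a : F) : f (s a) = x • a :=
    congrArg Subtype.val (e.apply_symm_apply ⟨x • a, (hfp _).1 (hpx a)⟩)
  have hs' (a : F) : (1 : B) ⊗ₜ[A] s a = 0 ↔ p a = 0 := by
    rw [one_tmul_eq_zero_iff hsurj hker, hfp]
    refine exists_congr fun l ↦ ?_
    rw [← hf.eq_iff, hs, map_smul]
    exact hF.eq_iff
  let j₀ : (F ⧸ LinearMap.ker p) →ₗ[A] B ⊗[A] L :=
    (LinearMap.ker p).liftQ (TensorProduct.mk A B L 1 ∘ₗ s) fun a ha ↦ (hs' a).2 ha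
  let j : N →ₗ[B] B ⊗[A] L := LinearMap.extendScalarsOfSurjective hsurj
    (j₀ ∘ₗ (p.quotKerEquivOfSurjective hp).symm.toLinearMap)
  have hj (a : F) : j (p a) = 1 ⊗ₜ s a := by
    have : (p.quotKerEquivOfSurjective hp).symm (p a) = Submodule.Quotient.mk a :=
      (LinearEquiv.symm_apply_eq _).2 rfl
    change j₀ ((p.quotKerEquivOfSurjective hp).symm (p a)) = _
    rw [this]
    rfl
  refine ⟨j, (injective_iff_map_eq_zero _).2 fun y hy ↦ ?_, fun z ↦ ?_⟩
  · obtain ⟨a, rfl⟩ := hp y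
    exact (hs' a).1 ((hj a).symm.trans hy)
  · obtain ⟨l, rfl⟩ := TensorProduct.mk_surjective A L B hsurj z
    rw [TensorProduct.mk_apply, LinearMap.baseChange_tmul, one_tmul_eq_zero_iff hsurj hker]
    constructor
    · rintro ⟨a, ha⟩
      exact ⟨p a, by rw [hj, hf (ha.symm.trans (hs a).symm)]⟩
    · rintro ⟨y, hy⟩
      obtain ⟨a, rfl⟩ := hp y
      rw [hj, ← sub_eq_zero, ← tmul_sub,
        one_tmul_eq_zero_iff hsurj hker] at hy
      obtain ⟨l', hl'⟩ := hy
      refine ⟨a - f l', ?_⟩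
      rw [smul_sub, ← hs, ← map_smul, hl', map_sub, sub_sub_cancel]

/-- The change-of-rings sequence: for an `A/x`-module `N`, vanishing of `Tor^{A/x}_i(N, Y)` for all
large `i` implies vanishing of `Tor^A_i(N, Y)` for all large `i`. -/
theorem torSuccVanishes_of_quotient {N Y : Type u} [AddCommGroup N]
    [Module A N] [Module B N] [IsScalarTower A B N] [AddCommGroup Y]
    [Module A Y] [Module B Y] [IsScalarTower A B Y]
    (hsurj : Surjective (algebraMap A B))
    (hker : RingHom.ker (algebraMap A B) = Ideal.span {x}) (hx : IsSMulRegular A x) {i : ℕ}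
    (h : TorSuccVanishes B Y i N) (h' : TorSuccVanishes B Y (i + 1) N) :
    TorSuccVanishes A Y (i + 1) N := by
  have hF : IsSMulRegular (N →₀ A) x := fun a b hab ↦
    Finsupp.ext fun n ↦ hx (DFunLike.congr_fun hab n)
  have hL : IsSMulRegular (Syzygy A N) x :=
    IsSMulRegular.of_injective (Syzygy.incl A N) (Syzygy.incl_injective A N) hF
  obtain ⟨j, hj, hjf⟩ := exists_injective_exact_baseChange hsurj hker hF
    (Syzygy.incl_injective A N) (Syzygy.exact A N) (Syzygy.cover_surjective A N)
  -- `0 → N → L/xL → F/xF → N → 0` is exact, where `0 → L → F → N → 0` is the free presentation of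
  -- `N` over `A`. It is cut into two short exact sequences.
  let q : B ⊗[A] (N →₀ A) →ₗ[B] N := (Syzygy.cover A N).liftBaseChange B
  have hq (a : N →₀ A) : q (1 ⊗ₜ a) = Syzygy.cover A N a := by simp [q]
  have hqs : Surjective q := fun n ↦ by
    obtain ⟨a, rfl⟩ := Syzygy.cover_surjective A N n
    exact ⟨_, hq a⟩
  have hfq : Exact ((Syzygy.incl A N).baseChange B) q := fun z ↦ by
    obtain ⟨a, rfl⟩ := TensorProduct.mk_surjective A (N →₀ A) B hsurj z
    rw [TensorProduct.mk_apply, hq, Syzygy.exact A N a]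
    constructor
    · rintro ⟨l, rfl⟩
      exact ⟨1 ⊗ₜ l, by simp⟩
    · rintro ⟨w, hw⟩
      obtain ⟨l, rfl⟩ := TensorProduct.mk_surjective A _ B hsurj w
      rw [← Syzygy.exact A N a, ← hq, ← hw]
      simp [hq, (Syzygy.exact A N).apply_apply_eq_zero]
  obtain ⟨Ω, e, f, -, he, hf, hje, hfq'⟩ := exists_exact_factorization hjf hfq
  rw [torSuccVanishes_succ_iff (Syzygy.incl_injective A N) (Syzygy.exact A N)
    (Syzygy.cover_surjective A N), ← torSuccVanishes_baseChange_iff (B := B)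
    (torSuccVanishes_quotient hsurj hker hx hL), torSuccVanishes_comm]
  exact (torSuccVanishes_comm.1 h).middle hj hje he
    (torSuccVanishes_comm.1 ((torSuccVanishes_succ_iff hf hfq' hqs).1 h'))

variable [IsLocalRing A] [IsLocalRing B]

theorem exists_residueField_equiv (hsurj : Surjective (algebraMap A B)) :
    ∃ e : ResidueField A ≃ₗ[A] ResidueField B, e 1 = 1 := by
  have hs : Surjective (algebraMap A (ResidueField B)) := by
    rw [IsScalarTower.algebraMap_eq A B (ResidueField B)]
    exact residue_surjective.comp hsurj
  have hker : LinearMap.ker (Algebra.linearMap A (ResidueField B)) = maximalIdeal A :=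
    eq_maximalIdeal (RingHom.ker_isMaximal_of_surjective (algebraMap A (ResidueField B)) hs)
  refine ⟨(Submodule.quotEquivOfEq _ _ hker.symm).trans
    (LinearMap.quotKerEquivOfSurjective (Algebra.linearMap A (ResidueField B)) hs), ?_⟩
  exact map_one (algebraMap A (ResidueField B))

theorem torSuccVanishes_residueField_iff (hsurj : Surjective (algebraMap A B)) (i : ℕ) :
    TorSuccVanishes A (ResidueField B) i X ↔ TorSuccVanishes A (ResidueField A) i X := by
  obtain ⟨e, -⟩ := exists_residueField_equiv (A := A) (B := B) hsurj
  exact ⟨fun h ↦ h.of_retract (s := e.toLinearMap) (r := e.symm.toLinearMap) (by ext; simp),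
    fun h ↦ h.of_retract (s := e.symm.toLinearMap) (r := e.toLinearMap) (by ext; simp)⟩

/-- Tor-persistence lifts from `A/x` to `A` for a regular element `x`: a first syzygy `K` of `M` has
`x` as a regular element, and `Tor^A(K, K)` and `Tor^A(K, k)` vanish in large degrees if and only if
`Tor^{A/x}(K/xK, K/xK)` and `Tor^{A/x}(K/xK, k)` do. -/
theorem IsTorPersistent.of_quotient_regular [IsNoetherianRing A]
    (hsurj : Surjective (algebraMap A B))
    (hker : RingHom.ker (algebraMap A B) = Ideal.span {x}) (hx : IsSMulRegular A x)
    (hB : IsTorPersistent B) : IsTorPersistent A := by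
  have : IsNoetherianRing B := isNoetherianRing_of_surjective A B _ hsurj
  rw [isTorPersistent_iff] at hB ⊢
  rintro M _ _ _ ⟨N, hN⟩
  obtain ⟨n, K, f, p, _, hf, hfp, hp⟩ := exists_finite_free_presentation A M
  have hK : IsSMulRegular K x :=
    IsSMulRegular.of_injective f hf fun a b hab ↦ funext fun j ↦ hx (congrFun hab j)
  -- dimension shifting in both arguments
  have hKK (i : ℕ) (hi : N ≤ i) : TorSuccVanishes A K i K := by
    rw [← torSuccVanishes_succ_iff_right hf hfp hp, ← torSuccVanishes_succ_iff hf hfp hp]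
    exact hN (i + 2) (by omega)
  have hK' : Injective (x • LinearMap.id : K →ₗ[A] K) := hK
  have hbase := torSuccVanishes_quotient (B := B) hsurj hker hx hK
  have hmk : Surjective (TensorProduct.mk A B K 1) := TensorProduct.mk_surjective A K B hsurj
  obtain ⟨N', hN'⟩ := hB (B ⊗[A] K) ⟨N + 1, fun i hi ↦ by
    obtain ⟨i, rfl⟩ := Nat.exists_eq_succ_of_ne_zero (by omega : i ≠ 0)
    rw [torSuccVanishes_baseChange_iff hbase]
    exact (hKK i (by omega)).right hK' (exact_smul_mk hsurj hker) hmk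
      (hKK (i + 1) (by omega))⟩
  refine ⟨N' + 1, fun i hi ↦ ?_⟩
  obtain ⟨i, rfl⟩ := Nat.exists_eq_succ_of_ne_zero (by omega : i ≠ 0)
  rw [torSuccVanishes_succ_iff hf hfp hp, ← torSuccVanishes_residueField_iff (B := B) hsurj,
    ← torSuccVanishes_baseChange_iff hbase]
  exact hN' i (by omega)

/-- If `x ∈ 𝔪 \ 𝔪²`, the residue field is a direct summand of `𝔪/x𝔪`. -/
theorem exists_residueField_retract (hsurj : Surjective (algebraMap A B))
    (hker : RingHom.ker (algebraMap A B) = Ideal.span {x}) (hxm : x ∈ maximalIdeal A)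
    (hxm2 : x ∉ maximalIdeal A ^ 2) :
    ∃ (s : ResidueField B →ₗ[B] B ⊗[A] maximalIdeal A)
      (r : B ⊗[A] maximalIdeal A →ₗ[B] ResidueField B), r ∘ₗ s = LinearMap.id := by
  obtain ⟨e, he⟩ := exists_residueField_equiv (A := A) (B := B) hsurj
  let x' : maximalIdeal A := ⟨x, hxm⟩
  obtain ⟨φ, hφ⟩ : ∃ φ : CotangentSpace A →ₗ[ResidueField A] ResidueField A,
      φ ((maximalIdeal A).toCotangent x') = 1 := by
    have h0 : (maximalIdeal A).toCotangent x' ≠ 0 := by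
      rwa [Ne, Ideal.toCotangent_eq_zero]
    obtain ⟨φ, hφ⟩ := not_forall.1
      (mt (Module.forall_dual_apply_eq_zero_iff (ResidueField A) (V := CotangentSpace A) _).1 h0)
    exact ⟨(φ ((maximalIdeal A).toCotangent x'))⁻¹ • φ, inv_mul_cancel₀ hφ⟩
  let l : maximalIdeal A →ₗ[A] ResidueField B :=
    e.toLinearMap ∘ₗ φ.restrictScalars A ∘ₗ (maximalIdeal A).toCotangent
  have hl : l x' = 1 := by
    change e (φ ((maximalIdeal A).toCotangent x')) = 1
    rw [hφ, he]
  -- `k → 𝔪/x𝔪` sends `1` to the class of `x`; it is well defined since `𝔪 x ⊆ x𝔪`.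
  let s₀ : ResidueField A →ₗ[A] B ⊗[A] maximalIdeal A :=
    Submodule.liftQ (maximalIdeal A)
      (TensorProduct.mk A B (maximalIdeal A) 1 ∘ₗ LinearMap.toSpanSingleton A _ x') fun a ha ↦
        (one_tmul_eq_zero_iff hsurj hker _).2 ⟨⟨a, ha⟩, Subtype.ext (mul_comm x a)⟩
  have hs₀ : s₀ 1 = 1 ⊗ₜ x' := by
    change (1 : B) ⊗ₜ[A] ((1 : A) • x') = 1 ⊗ₜ x'
    rw [one_smul]
  refine ⟨LinearMap.extendScalarsOfSurjective hsurj (s₀ ∘ₗ e.symm.toLinearMap),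
    l.liftBaseChange B, ?_⟩
  have h1 : (l.liftBaseChange B) (s₀ (e.symm 1)) = 1 := by
    rw [(LinearEquiv.symm_apply_eq e).2 he.symm, hs₀, LinearMap.liftBaseChange_tmul, hl, one_smul]
  ext b
  obtain ⟨b, rfl⟩ := residue_surjective b
  rw [← mul_one (residue B b), ← ResidueField.algebraMap_eq, ← Algebra.smul_def, map_smul, map_smul]
  exact congrArg (b • ·) h1

/-- Tor-persistence descends from `A` to `A/x` for a regular element `x ∈ 𝔪 \ 𝔪²`. For such `x` the
residue field `k` is a direct summand of `𝔪/x𝔪`, so `Tor^{A/x}(N, k)` is a direct summand of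
`Tor^{A/x}(N, 𝔪/x𝔪) = Tor^A(N, 𝔪)`. -/
theorem IsTorPersistent.quotient_regular [IsNoetherianRing A]
    (hsurj : Surjective (algebraMap A B))
    (hker : RingHom.ker (algebraMap A B) = Ideal.span {x}) (hx : IsSMulRegular A x)
    (hxm : x ∈ maximalIdeal A) (hxm2 : x ∉ maximalIdeal A ^ 2)
    (hA : IsTorPersistent A) : IsTorPersistent B := by
  have : IsNoetherianRing B := isNoetherianRing_of_surjective A B _ hsurj
  rw [isTorPersistent_iff] at hA ⊢
  rintro M _ _ _ ⟨N, hN⟩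
  let _ : Module A M := Module.compHom M (algebraMap A B)
  have : IsScalarTower A B M := IsScalarTower.of_algebraMap_smul fun _ _ ↦ rfl
  have : Module.Finite A B := Module.Finite.of_surjective (Algebra.linearMap A B) hsurj
  have : Module.Finite A M := Module.Finite.trans B M
  obtain ⟨N', hN'⟩ := hA M ⟨N + 1, fun i hi ↦ by
    obtain ⟨i, rfl⟩ := Nat.exists_eq_succ_of_ne_zero (by omega : i ≠ 0)
    exact torSuccVanishes_of_quotient hsurj hker hx (hN i (by omega)) (hN (i + 1) (by omega))⟩
  obtain ⟨s, r, hrs⟩ := exists_residueField_retract hsurj hker hxm hxm2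
  have hm : IsSMulRegular (maximalIdeal A) x :=
    IsSMulRegular.of_injective (maximalIdeal A).subtype Subtype.val_injective hx
  refine ⟨N', fun i hi ↦ TorSuccVanishes.of_retract hrs ?_⟩
  rw [torSuccVanishes_comm,
    torSuccVanishes_baseChange_iff (torSuccVanishes_quotient hsurj hker hx hm),
    ← torSuccVanishes_succ_iff Subtype.val_injective
      (LinearMap.exact_subtype_mkQ (maximalIdeal A)) (Submodule.mkQ_surjective _), torSuccVanishes_comm]
  exact hN' (i + 1) (by omega)

theorem isTorPersistent_iff_of_surjective {A B : Type u} [CommRing A] [CommRing B] [IsLocalRing A]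
    [IsLocalRing B] [IsNoetherianRing A] {φ : A →+* B} {x : A} (hφ : Surjective φ)
    (hker : RingHom.ker φ = Ideal.span {x}) (hx : IsSMulRegular A x)
    (hxm : x ∈ maximalIdeal A) (hxm2 : x ∉ maximalIdeal A ^ 2) :
    IsTorPersistent A ↔ IsTorPersistent B := by
  let _ : Algebra A B := φ.toAlgebra
  exact ⟨fun h ↦ h.quotient_regular (x := x) hφ hker hx hxm hxm2,
    fun h ↦ h.of_quotient_regular (x := x) hφ hker hx⟩

end RegularQuotient

/-! ### Power series rings -/

section PowerSeries

open Function IsLocalRing PowerSeries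

/-- This is how elements are shown not to lie in the square of a maximal ideal. -/
theorem Derivation.map_mem_of_mem_sq {R S : Type*} [CommRing R] [CommRing S] [Algebra R S]
    (D : Derivation R S S) {I : Ideal S} {f : S} (hf : f ∈ I ^ 2) : D f ∈ I := by
  rw [pow_two] at hf
  induction hf using Submodule.mul_induction_on' with
  | mem_mul_mem a ha b hb =>
    rw [D.leibniz]
    exact I.add_mem (I.mul_mem_right _ ha) (I.mul_mem_right _ hb)
  | add a _ b _ ha hb => rw [map_add]; exact I.add_mem ha hb

variable {A : Type u} [CommRing A]

theorem coeff_X_sub_C_mul (a : A) (g : A⟦X⟧) (n : ℕ) :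
    coeff (n + 1) ((X - C a) * g) = coeff n g - a * coeff (n + 1) g := by
  rw [sub_mul, map_sub, coeff_succ_X_mul, coeff_C_mul]

theorem coeff_zero_X_sub_C_mul (a : A) (g : A⟦X⟧) :
    coeff 0 ((X - C a) * g) = -(a * coeff 0 g) := by
  rw [sub_mul, map_sub, coeff_zero_X_mul, coeff_C_mul, zero_sub]

/-- If the constant `r` is a multiple of `X - a`, then it is divisible by all powers of `a`. -/
theorem pow_dvd_of_X_sub_C_mul_eq_C {a r : A} {g : A⟦X⟧} (h : (X - C a) * g = C r) (n : ℕ) :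
    a ^ n ∣ r := by
  have h0 : r = -(a * coeff 0 g) := by rw [← coeff_zero_X_sub_C_mul, h, coeff_zero_C]
  have h1 (k : ℕ) : coeff k g = a * coeff (k + 1) g := by
    rw [← sub_eq_zero, ← coeff_X_sub_C_mul, h, coeff_C, if_neg (by omega)]
  have h2 (k : ℕ) : coeff 0 g = a ^ k * coeff k g := by
    induction k with
    | zero => simp
    | succ k ih => rw [ih, h1 k, pow_succ, mul_assoc]
  exact ⟨-(a * coeff n g), by rw [h0, h2 n]; ring⟩

variable [IsLocalRing A]

theorem X_sub_C_mem_maximalIdeal {a : A} (ha : a ∈ maximalIdeal A) :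
    X - C a ∈ maximalIdeal A⟦X⟧ := by
  rw [mem_maximalIdeal, mem_nonunits_iff, isUnit_iff_constantCoeff] at *
  simpa using ha

theorem X_sub_C_notMem_maximalIdeal_sq (a : A) : X - C a ∉ maximalIdeal A⟦X⟧ ^ 2 := fun h ↦ by
  have h1 := Derivation.map_mem_of_mem_sq (derivative A) h
  rw [map_sub, derivative_C, derivative_X, sub_zero] at h1
  exact (maximalIdeal.isMaximal _).ne_top ((Ideal.eq_top_iff_one _).2 h1)

variable [IsNoetherianRing A]

/-- If `(X - a) g = 0`, every coefficient of `g` is `a` times the next one, so all of them lie in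
`⋂ 𝔪ⁿ = 0`. -/
theorem isSMulRegular_X_sub_C {a : A} (ha : a ∈ maximalIdeal A) :
    IsSMulRegular A⟦X⟧ (X - C a) := by
  refine (isSMulRegular_iff_right_eq_zero_of_smul).2 fun g hg ↦ ?_
  have h1 (k : ℕ) : coeff k g = a * coeff (k + 1) g := by
    rw [← sub_eq_zero, ← coeff_X_sub_C_mul, ← smul_eq_mul, hg, map_zero]
  have h2 (n k : ℕ) : coeff k g ∈ maximalIdeal A ^ n := by
    induction n generalizing k with
    | zero => simp
    | succ n ih => rw [h1, pow_succ']; exact Ideal.mul_mem_mul ha (ih _)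
  ext k
  rw [map_zero, ← Ideal.mem_bot, ← Ideal.iInf_pow_eq_bot_of_isLocalRing (maximalIdeal A)
    (maximalIdeal.isMaximal _).ne_top, Submodule.mem_iInf]
  exact fun n ↦ h2 n k

theorem isTorPersistent_powerSeries_iff_of_surjective {B : Type u} [CommRing B] [IsLocalRing B]
    {a : A} (ha : a ∈ maximalIdeal A) {φ : A⟦X⟧ →+* B} (hφ : Surjective φ)
    (hker : RingHom.ker φ = Ideal.span {X - C a}) :
    IsTorPersistent A⟦X⟧ ↔ IsTorPersistent B :=
  isTorPersistent_iff_of_surjective hφ hker (isSMulRegular_X_sub_C ha)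
    (X_sub_C_mem_maximalIdeal ha) (X_sub_C_notMem_maximalIdeal_sq a)

theorem isTorPersistent_powerSeries_iff_of_ringEquiv {B : Type u} [CommRing B] [IsLocalRing B]
    (e : A ≃+* B) : IsTorPersistent A⟦X⟧ ↔ IsTorPersistent B := by
  refine isTorPersistent_powerSeries_iff_of_surjective (zero_mem _)
    (φ := (e : A →+* B).comp constantCoeff) (e.surjective.comp constantCoeff_surj) ?_
  ext f
  rw [RingHom.mem_ker, RingHom.comp_apply, RingHom.coe_coe, map_eq_zero_iff _ e.injective, map_zero,
    sub_zero, Ideal.mem_span_singleton, X_dvd_iff]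

theorem isTorPersistent_powerSeries_iff : IsTorPersistent A⟦X⟧ ↔ IsTorPersistent A :=
  isTorPersistent_powerSeries_iff_of_ringEquiv (RingEquiv.refl A)

/-- Both rings are the quotient of `A⟦X⟧` by `X`. -/
theorem isTorPersistent_iff_of_ringEquiv {B : Type u} [CommRing B] [IsLocalRing B]
    (e : A ≃+* B) : IsTorPersistent A ↔ IsTorPersistent B :=
  isTorPersistent_powerSeries_iff.symm.trans (isTorPersistent_powerSeries_iff_of_ringEquiv e)

theorem isTorPersistent_mvPowerSeries_iff (n : ℕ) :
    IsTorPersistent (MvPowerSeries (Fin n) A) ↔ IsTorPersistent A := by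
  induction n with
  | zero =>
    exact isTorPersistent_iff_of_ringEquiv (MvPowerSeries.isEmptyEquiv (Fin 0) A).toRingEquiv
  | succ n ih =>
    rw [isTorPersistent_iff_of_ringEquiv (MvPowerSeries.finSuccEquiv A n).toRingEquiv,
      isTorPersistent_powerSeries_iff, ih]

end PowerSeries

/-! ### Localized polynomial rings -/

section Polynomial

open Function IsLocalRing

theorem localRingHom_surjective {P P' : Type*} [CommRing P] [CommRing P'] (p : Ideal P)
    [p.IsPrime] (p' : Ideal P') [p'.IsPrime] (φ : P →+* P') (hp : p = p'.comap φ)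
    (hφ : Surjective φ) : Surjective (Localization.localRingHom p p' φ hp) := fun z ↦ by
  obtain ⟨a', s', rfl⟩ := IsLocalization.exists_mk'_eq p'.primeCompl z
  obtain ⟨a, rfl⟩ := hφ a'
  obtain ⟨s, hs⟩ := hφ s'
  have hsp : s ∈ p.primeCompl := fun h ↦ s'.2 (hs ▸ Ideal.mem_comap.1 (hp ▸ h))
  refine ⟨IsLocalization.mk' _ a ⟨s, hsp⟩, ?_⟩
  rw [Localization.localRingHom_mk']
  congr

theorem ker_localRingHom {P P' : Type*} [CommRing P] [CommRing P'] (p : Ideal P)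
    [p.IsPrime] (p' : Ideal P') [p'.IsPrime] (φ : P →+* P') (hp : p = p'.comap φ)
    (hφ : Surjective φ) :
    RingHom.ker (Localization.localRingHom p p' φ hp) =
      (RingHom.ker φ).map (algebraMap P (Localization.AtPrime p)) := by
  ext z
  obtain ⟨a, s, rfl⟩ := IsLocalization.exists_mk'_eq p.primeCompl z
  rw [RingHom.mem_ker, Localization.localRingHom_mk', IsLocalization.mk'_eq_zero_iff,
    IsLocalization.mk'_mem_map_algebraMap_iff]
  constructor
  · rintro ⟨⟨t', ht'⟩, h⟩
    obtain ⟨t, rfl⟩ := hφ t'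
    refine ⟨t, fun h ↦ ht' (by rwa [hp] at h), ?_⟩
    rwa [RingHom.mem_ker, map_mul]
  · rintro ⟨t, ht, h⟩
    rw [RingHom.mem_ker, map_mul] at h
    exact ⟨⟨φ t, fun h' ↦ ht (by rwa [hp])⟩, h⟩

variable (R : Type u) [CommRing R] (n : ℕ)

/-- Setting the first variable to zero. -/
noncomputable def killFirstVariable :
    MvPolynomial (Fin (n + 1)) R →+* MvPolynomial (Fin n) R :=
  (Polynomial.constantCoeff).comp (MvPolynomial.finSuccEquiv R n : _ →+* _)

theorem killFirstVariable_surjective : Surjective (killFirstVariable R n) :=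
  Surjective.comp (g := Polynomial.constantCoeff) (fun p ↦ ⟨Polynomial.C p, by simp⟩)
    (MvPolynomial.finSuccEquiv R n).surjective

theorem ker_killFirstVariable :
    RingHom.ker (killFirstVariable R n) = Ideal.span {MvPolynomial.X 0} := by
  ext f
  rw [RingHom.mem_ker, Ideal.mem_span_singleton,
    ← map_dvd_iff (MvPolynomial.finSuccEquiv R n), MvPolynomial.finSuccEquiv_X_zero,
    Polynomial.X_dvd_iff]
  rfl

variable [IsLocalRing R]

theorem polyMaximalIdeal_eq_comap_killFirstVariable :
    polyMaximalIdeal R (n + 1) = (polyMaximalIdeal R n).comap (killFirstVariable R n) := by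
  rw [polyMaximalIdeal_eq_comap, polyMaximalIdeal_eq_comap, Ideal.comap_comap]
  congr 1
  apply MvPolynomial.ringHom_ext
  · intro r
    simp [killFirstVariable, MvPolynomial.finSuccEquiv_apply]
  · intro i
    refine Fin.cases ?_ (fun j ↦ ?_) i
    · simp [killFirstVariable, MvPolynomial.finSuccEquiv_X_zero]
    · simp [killFirstVariable, MvPolynomial.finSuccEquiv_X_succ]

theorem isSMulRegular_X_localization :
    IsSMulRegular (Localization.AtPrime (polyMaximalIdeal R (n + 1)))
      (algebraMap (MvPolynomial (Fin (n + 1)) R) (Localization.AtPrime (polyMaximalIdeal R (n + 1)))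
        (MvPolynomial.X 0)) := by
  have h : (MvPolynomial.X 0 : MvPolynomial (Fin (n + 1)) R) ∈ nonZeroDivisors _ :=
    (MvPolynomial.isRegular_X (n := 0)).mem_nonZeroDivisors
  have h' := IsLocalization.map_nonZeroDivisors_le (polyMaximalIdeal R (n + 1)).primeCompl
    (Localization.AtPrime (polyMaximalIdeal R (n + 1))) (Submonoid.mem_map_of_mem _ h)
  exact (isRegular_iff_mem_nonZeroDivisors.2 h').left

theorem X_notMem_maximalIdeal_sq_localization :
    algebraMap (MvPolynomial (Fin (n + 1)) R) (Localization.AtPrime (polyMaximalIdeal R (n + 1)))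
        (MvPolynomial.X 0) ∉
      maximalIdeal (Localization.AtPrime (polyMaximalIdeal R (n + 1))) ^ 2 := by
  set p := polyMaximalIdeal R (n + 1) with hp
  have hX : MvPolynomial.X 0 ∈ p := by
    rw [hp, polyMaximalIdeal_eq_comap, Ideal.mem_comap, MvPolynomial.constantCoeff_X]
    exact zero_mem _
  intro h
  rw [← Localization.AtPrime.map_eq_maximalIdeal, ← Ideal.map_pow,
    IsLocalization.algebraMap_mem_map_algebraMap_iff p.primeCompl] at h
  obtain ⟨t, ht, h⟩ := h
  have h1 := Derivation.map_mem_of_mem_sq (MvPolynomial.pderiv 0) h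
  rw [Derivation.leibniz, MvPolynomial.pderiv_X_self, smul_eq_mul, smul_eq_mul, mul_one] at h1
  exact ht ((p.add_mem_iff_left (p.mul_mem_right _ hX)).1 h1)

theorem isTorPersistent_localization_iff [IsNoetherianRing R] :
    IsTorPersistent (Localization.AtPrime (polyMaximalIdeal R n)) ↔ IsTorPersistent R := by
  induction n with
  | zero =>
    have hle : (polyMaximalIdeal R 0).primeCompl ≤ IsUnit.submonoid _ := fun f hf ↦ by
      obtain ⟨r, rfl⟩ := MvPolynomial.C_surjective (Fin 0) f
      have h1 : IsUnit r := by
        by_contra h2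
        refine hf ?_
        rw [SetLike.mem_coe, polyMaximalIdeal_eq_comap]
        simpa using h2
      exact h1.map MvPolynomial.C
    have e := (IsLocalization.atUnits (MvPolynomial (Fin 0) R) (polyMaximalIdeal R 0).primeCompl
      (S := Localization.AtPrime (polyMaximalIdeal R 0)) hle).toRingEquiv.symm.trans
        (MvPolynomial.isEmptyRingEquiv R (Fin 0))
    exact isTorPersistent_iff_of_ringEquiv e
  | succ n ih =>
    rw [← ih]
    have hker := ker_localRingHom _ _ _ (polyMaximalIdeal_eq_comap_killFirstVariable R n)
      (killFirstVariable_surjective R n)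
    rw [ker_killFirstVariable, Ideal.map_span, Set.image_singleton] at hker
    refine isTorPersistent_iff_of_surjective
      (localRingHom_surjective _ _ _ (polyMaximalIdeal_eq_comap_killFirstVariable R n)
        (killFirstVariable_surjective R n)) hker (isSMulRegular_X_localization R n) ?_
      (X_notMem_maximalIdeal_sq_localization R n)
    rw [← Localization.AtPrime.map_eq_maximalIdeal]
    apply Ideal.mem_map_of_mem
    rw [polyMaximalIdeal_eq_comap, Ideal.mem_comap, MvPolynomial.constantCoeff_X]
    exact zero_mem _

end Polynomial

/-! ### The completion -/

section Completion

open Function IsLocalRing PowerSeries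

/-- `A⟦X⟧/(X - a)`, the `a`-adic completion of `A`. -/
abbrev PowerSeriesQuotient (A : Type u) [CommRing A] (a : A) : Type u :=
  A⟦X⟧ ⧸ Ideal.span {(X - C a : A⟦X⟧)}

variable {A : Type u} [CommRing A]

theorem coeff_mem_of_mem_map_C {I : Ideal A} {f : A⟦X⟧} (hf : f ∈ I.map (C : A →+* A⟦X⟧)) (n : ℕ) :
    coeff n f ∈ I := by
  have h : I.map (C : A →+* A⟦X⟧) ≤ RingHom.ker (PowerSeries.map (Ideal.Quotient.mk I)) := by
    rw [Ideal.map_le_iff_le_comap]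
    intro r hr
    rw [Ideal.mem_comap, RingHom.mem_ker, PowerSeries.map_C, Ideal.Quotient.eq_zero_iff_mem.2 hr,
      map_zero]
  have h1 := congrArg (coeff n) ((RingHom.mem_ker).1 (h hf))
  rwa [coeff_map, map_zero, Ideal.Quotient.eq_zero_iff_mem] at h1

/-- If `I` contains a power of `a`, then extending `I` to `A⟦X⟧/(X - a)` and contracting it again
adds no elements. -/
theorem comap_map_powerSeriesQuotient {a : A} {I : Ideal A} {n : ℕ} (hI : a ^ n ∈ I) :
    (I.map ((Ideal.Quotient.mk (Ideal.span {(X - C a : A⟦X⟧)})).comp C)).comap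
      ((Ideal.Quotient.mk (Ideal.span {(X - C a : A⟦X⟧)})).comp C) ≤ I := by
  intro r hr
  rw [Ideal.mem_comap, ← Ideal.map_map, RingHom.comp_apply,
    Ideal.mem_map_iff_of_surjective _ Ideal.Quotient.mk_surjective] at hr
  obtain ⟨f, hf, hfr⟩ := hr
  rw [eq_comm, Ideal.Quotient.eq, Ideal.mem_span_singleton] at hfr
  obtain ⟨g, hg⟩ := hfr
  have hφ (k : ℕ) : Ideal.Quotient.mk I (coeff k f) = 0 :=
    Ideal.Quotient.eq_zero_iff_mem.2 (coeff_mem_of_mem_map_C hf k)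
  have h1 : (X - C (Ideal.Quotient.mk I a)) * PowerSeries.map (Ideal.Quotient.mk I) g =
      C (Ideal.Quotient.mk I r) := by
    have h2 := congrArg (PowerSeries.map (Ideal.Quotient.mk I)) hg
    have h3 : PowerSeries.map (Ideal.Quotient.mk I) f = 0 := by
      ext k
      rw [coeff_map, hφ, map_zero]
    simpa [h3] using h2.symm
  have h2 := pow_dvd_of_X_sub_C_mul_eq_C h1 n
  rwa [← map_pow, Ideal.Quotient.eq_zero_iff_mem.2 hI, zero_dvd_iff,
    Ideal.Quotient.eq_zero_iff_mem] at h2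

/-- For elements `a 0, …, a (n-1)` of the maximal ideal of `R`, adjoining their power series one at
a time produces a ring `S` which behaves like the `(a 0, …, a (n-1))`-adic completion of `R`: it is
the image of a power series ring by a map sending the variables to the `a i`, and it has the
same quotients by powers of the maximal ideal of `R`. -/
theorem exists_quotient_mvPowerSeries (R : Type u) [CommRing R] [IsNoetherianRing R]
    [IsLocalRing R] (n : ℕ) (a : Fin n → R) (ha : ∀ i, a i ∈ maximalIdeal R) :
    ∃ (S : Type u) (_ : CommRing S) (_ : IsLocalRing S) (_ : IsNoetherianRing S)
      (π : MvPowerSeries (Fin n) R →+* S), Surjective π ∧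
      (∀ i, π (MvPowerSeries.X i) = π (MvPowerSeries.C (a i))) ∧
      (∀ k, ((maximalIdeal R ^ k).map (π.comp MvPowerSeries.C)).comap (π.comp MvPowerSeries.C) ≤
        maximalIdeal R ^ k) ∧
      (∀ s, ∃ r, s - π (MvPowerSeries.C r) ∈ (maximalIdeal R).map (π.comp MvPowerSeries.C)) ∧
      (IsTorPersistent R ↔ IsTorPersistent S) := by
  induction n with
  | zero =>
    let e := (MvPowerSeries.isEmptyEquiv (Fin 0) R).toRingEquiv
    have h : (e : MvPowerSeries (Fin 0) R →+* R).comp MvPowerSeries.C = RingHom.id R := by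
      ext r
      exact (MvPowerSeries.isEmptyEquiv (Fin 0) R).apply_symm_apply r
    refine ⟨R, inferInstance, inferInstance, inferInstance, e, e.surjective, fun i ↦ i.elim0,
      fun k ↦ ?_, fun s ↦ ⟨s, ?_⟩, Iff.rfl⟩
    · rw [h, Ideal.map_id, Ideal.comap_id]
    · rw [show (e : MvPowerSeries (Fin 0) R →+* R) (MvPowerSeries.C s) = s from
        RingHom.congr_fun h s, sub_self]
      exact zero_mem _
  | succ n ih =>
    obtain ⟨S, _, _, _, π, hπ, hπX, hcomap, hmod, hiff⟩ := ih (fun i ↦ a i.succ) fun i ↦ ha _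
    let b : S := π (MvPowerSeries.C (a 0))
    have hb : b ∈ maximalIdeal S := by
      have h1 : (maximalIdeal R ^ 1).map (π.comp MvPowerSeries.C) ≠ ⊤ := fun h ↦ by
        have := hcomap 1
        rw [h, Ideal.comap_top, pow_one, top_le_iff] at this
        exact (maximalIdeal.isMaximal R).ne_top this
      refine le_maximalIdeal h1 ?_
      rw [pow_one]
      exact Ideal.mem_map_of_mem (π.comp MvPowerSeries.C) (ha 0)
    let q : S⟦X⟧ →+* PowerSeriesQuotient S b := Ideal.Quotient.mk _
    have hnt : Nontrivial (PowerSeriesQuotient S b) := by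
      refine Ideal.Quotient.nontrivial_iff.2 fun h ↦ ?_
      refine (maximalIdeal.isMaximal S⟦X⟧).ne_top (top_le_iff.1 (h ▸ ?_))
      rw [Ideal.span_singleton_le_iff_mem]
      exact X_sub_C_mem_maximalIdeal hb
    have : IsLocalRing (PowerSeriesQuotient S b) :=
      IsLocalRing.of_surjective' q Ideal.Quotient.mk_surjective
    let π' : MvPowerSeries (Fin (n + 1)) R →+* PowerSeriesQuotient S b :=
      (q.comp (PowerSeries.map π)).comp (MvPowerSeries.finSuccEquiv R n : _ →+* _)
    have hπC (r : R) : π' (MvPowerSeries.C r) = q (C (π (MvPowerSeries.C r))) := by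
      simp [π']
    have hcomp : π'.comp MvPowerSeries.C = (q.comp C).comp (π.comp MvPowerSeries.C) :=
      RingHom.ext hπC
    refine ⟨PowerSeriesQuotient S b, inferInstance, this, inferInstance, π', ?_, ?_, ?_, ?_, ?_⟩
    · exact (Ideal.Quotient.mk_surjective.comp (PowerSeries.map_surjective _ hπ)).comp
        (MvPowerSeries.finSuccEquiv R n).surjective
    · intro i
      rw [hπC]
      refine Fin.cases ?_ (fun j ↦ ?_) i
      · have h1 : π' (MvPowerSeries.X 0) = q X := by
          simp [π']
        rw [h1]
        exact Ideal.Quotient.eq.2 (Ideal.mem_span_singleton_self _)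
      · have h1 : π' (MvPowerSeries.X j.succ) = q (C (π (MvPowerSeries.X j))) := by
          simp [π']
        rw [h1, hπX]
    · intro k
      rw [hcomp, ← Ideal.map_map, ← Ideal.comap_comap]
      refine (Ideal.comap_mono (comap_map_powerSeriesQuotient (n := k) ?_)).trans (hcomap k)
      have h1 := Ideal.mem_map_of_mem (π.comp MvPowerSeries.C) (Ideal.pow_mem_pow (ha 0) k)
      rwa [map_pow] at h1
    · intro s
      obtain ⟨f, rfl⟩ := Ideal.Quotient.mk_surjective s
      obtain ⟨r, hr⟩ := hmod (constantCoeff f)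
      refine ⟨r, ?_⟩
      have hX : q X = π' (MvPowerSeries.C (a 0)) := by
        rw [hπC]
        exact Ideal.Quotient.eq.2 (Ideal.mem_span_singleton_self _)
      have hf : q f - π' (MvPowerSeries.C r) =
          q (mk fun k ↦ coeff (k + 1) f) * π' (MvPowerSeries.C (a 0)) +
            (q.comp C) (constantCoeff f - π (MvPowerSeries.C r)) := by
        rw [hπC, ← hX, RingHom.comp_apply, ← map_mul, ← map_add, (C : S →+* S⟦X⟧).map_sub,
          ← add_sub_assoc, ← eq_shift_mul_X_add_const, map_sub]
      change q f - _ ∈ _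
      rw [hf]
      refine add_mem (Ideal.mul_mem_left _ _ (Ideal.mem_map_of_mem (π'.comp _) (ha 0))) ?_
      rw [hcomp, ← Ideal.map_map]
      exact Ideal.mem_map_of_mem _ hr
    · rw [hiff, ← isTorPersistent_powerSeries_iff (A := S)]
      exact isTorPersistent_powerSeries_iff_of_surjective hb Ideal.Quotient.mk_surjective
        Ideal.mk_ker

theorem isPrecomplete_map_of_surjective {P S : Type u} [CommRing P] [CommRing S] (I : Ideal P)
    [IsPrecomplete I P] {π : P →+* S} (hπ : Surjective π) : IsPrecomplete (I.map π) S := by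
  let _ : Algebra P S := π.toAlgebra
  refine IsPrecomplete.map_algebraMap_iff.2 (AdicCompletion.of_surjective_iff.1 fun y ↦ ?_)
  obtain ⟨z, rfl⟩ := AdicCompletion.map_surjective I (f := Algebra.linearMap P S) hπ y
  obtain ⟨p, rfl⟩ := AdicCompletion.of_surjective I P z
  exact ⟨Algebra.linearMap P S p, rfl⟩

/-- The ring `S` of `exists_quotient_mvPowerSeries`, for generators `a i` of the maximal ideal, is
complete as a quotient of a power series ring, and so it is the completion of `R`. -/
theorem isTorPersistent_adicCompletion_iff (R : Type u) [CommRing R] [IsNoetherianRing R]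
    [IsLocalRing R] :
    IsTorPersistent (AdicCompletion (maximalIdeal R) R) ↔ IsTorPersistent R := by
  set m := maximalIdeal R with hm
  obtain ⟨n, a, ha⟩ := Submodule.fg_iff_exists_fin_generating_family.1 m.fg_of_isNoetherianRing
  have ham (i : Fin n) : a i ∈ m := ha ▸ Submodule.subset_span ⟨i, rfl⟩
  obtain ⟨S, _, _, _, π, hπ, hπX, hcomap, hmod, hiff⟩ := exists_quotient_mvPowerSeries R n a ham
  let ι : R →+* S := π.comp MvPowerSeries.C
  let J : Ideal S := m.map ι
  have hJπ : J = (Ideal.span (Set.range MvPowerSeries.X)).map π := by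
    have h1 : m = Ideal.span (Set.range a) := ha.symm
    change m.map ι = _
    rw [h1, Ideal.map_span, Ideal.map_span, ← Set.range_comp, ← Set.range_comp]
    congr 2
    ext i
    exact (hπX i).symm
  have hJ : J ≠ ⊤ := fun h ↦ by
    have := hcomap 1
    rw [pow_one] at this
    change J.comap ι ≤ m at this
    rw [h, Ideal.comap_top, top_le_iff] at this
    exact (maximalIdeal.isMaximal R).ne_top this
  have hHaus : IsHausdorff J S := IsHausdorff.of_isLocalRing J S hJ
  have hPrec : IsPrecomplete J S := by
    rw [hJπ]
    exact isPrecomplete_map_of_surjective _ hπ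
  have hcomplete : IsAdicComplete J S := { }
  have hmJ (k : ℕ) : m ^ k ≤ (J ^ k).comap ι := by
    rw [← Ideal.map_le_iff_le_comap, Ideal.map_pow]
  let f (k : ℕ) : AdicCompletion m R →+* S ⧸ J ^ k :=
    (Ideal.quotientMap (J ^ k) ι (hmJ k)).comp (AdicCompletion.evalₐ m k : _ →+* _)
  let ψ : AdicCompletion m R →+* S := IsAdicComplete.liftRingHom J f fun {k l} hkl ↦ by
    ext z
    induction z using AdicCompletion.induction_on with
    | h z =>
      simp only [f, RingHom.comp_apply, RingHom.coe_coe, AdicCompletion.evalₐ_mk,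
        Ideal.quotientMap_mk, ← AdicCompletion.Ideal.mk_eq_mk m hkl z]
      rfl
  have hmk (k : ℕ) (z : AdicCompletion m R) : Ideal.Quotient.mk (J ^ k) (ψ z) = f k z :=
    IsAdicComplete.mk_liftRingHom J f _ k z
  have hψ (r : R) : ψ (algebraMap R _ r) = ι r := by
    refine (IsHausdorff.eq_iff_smodEq (I := J)).2 fun k ↦ ?_
    rw [SModEq.sub_mem, smul_eq_mul, Ideal.mul_top, ← Ideal.Quotient.eq, hmk]
    simp [f]
  -- the comparison map is injective because `R/𝔪ᵏ → S/Jᵏ` is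
  have hinj : Injective ψ := by
    refine (injective_iff_map_eq_zero _).2 fun z hz ↦ AdicCompletion.ext_evalₐ fun k ↦ ?_
    have h1 : f k z = 0 := by rw [← hmk, hz, map_zero]
    obtain ⟨r, hr⟩ := Ideal.Quotient.mk_surjective (AdicCompletion.evalₐ m k z)
    have h2 : Ideal.Quotient.mk (J ^ k) (ι r) = 0 := by
      rw [← h1]
      simp [f, ← hr]
    rw [Ideal.Quotient.eq_zero_iff_mem, ← Ideal.map_pow] at h2
    rw [← hr, map_zero, Ideal.Quotient.eq_zero_iff_mem]
    exact hcomap k h2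
  -- by completeness, surjectivity may be tested modulo `J`
  have hsurj : Surjective ψ := by
    have h1 : (m.map (algebraMap R (AdicCompletion m R))).map ψ = J := by
      rw [Ideal.map_map]
      congr 1
      exact RingHom.ext hψ
    have : IsPrecomplete (m.map (algebraMap R (AdicCompletion m R))) (AdicCompletion m R) :=
      (AdicCompletion.isAdicComplete_self m m.fg_of_isNoetherianRing).toIsPrecomplete
    have : IsHausdorff ((m.map (algebraMap R (AdicCompletion m R))).map ψ) S := h1 ▸ hHaus
    refine surjective_of_mk_map_comp_surjective
      (I := m.map (algebraMap R (AdicCompletion m R))) ψ ?_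
    intro y
    obtain ⟨s, rfl⟩ := Ideal.Quotient.mk_surjective y
    obtain ⟨r, hr⟩ := hmod s
    refine ⟨algebraMap R _ r, Eq.symm ?_⟩
    rw [RingHom.comp_apply, hψ, Ideal.Quotient.eq, h1]
    exact hr
  have e : S ≃+* AdicCompletion m R := (RingEquiv.ofBijective ψ ⟨hinj, hsurj⟩).symm
  rw [hiff, isTorPersistent_iff_of_ringEquiv e]

end Completion

theorem theorem1p1 (R : Type u) [CommRing R] [IsNoetherianRing R] [IsLocalRing R] (n : ℕ) :
    List.TFAE
      [IsTorPersistent R,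
       IsTorPersistent (AdicCompletion (IsLocalRing.maximalIdeal R) R),
       IsTorPersistent (MvPowerSeries (Fin n) R),
       IsTorPersistent (Localization.AtPrime (polyMaximalIdeal R n))] := by
  tfae_have 1 ↔ 2 := (isTorPersistent_adicCompletion_iff R).symm
  tfae_have 1 ↔ 3 := (isTorPersistent_mvPowerSeries_iff n).symm
  tfae_have 1 ↔ 4 := (isTorPersistent_localization_iff R n).symm
  tfae_finish
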